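/- Let $p$ be a prime, $R$ a commutative ring of characteristic $p$, and $r,m$ integers with $r\ge 1$ and $r+1<m$. Let $V_r(R[x_1,\dots,x_m])=\bigoplus_{k\ge 0} R[x_1,\dots,x_m]_{rk}$ be the $r$-th Veronese subring of the polynomial ring with its standard grading, its piece of degree $k$ being $R[x_1,\dots,x_m]_{rk}$. For an $\mathbb N$-graded commutative ring $\mathscr R$ of characteristic $p$ let $T(\mathscr R)=\bigoplus_{e\ge 0}\mathscr R_{p^e-1}$, with the multiplication $a\divideontimes b=ab^{p^e}$ for $a\in T(\mathscr R)_e$, $b\in T(\mathscr R)_{e'}$. Put $A=T(V_r(R[x_1,\dots,x_m]))$, an $\mathbb N$-graded, in general non-commutative, ring. For an $\mathbb N$-graded ring $A=\bigoplus_{e\ge0}A_e$ let $G_{-1}=A_0$, let $G_e$ ($e\ge 0$) be the subring generated by the homogeneous elements of degree at most $e$, and let $c_e(A)$ be the minimal number of generators of the left $A_0$-module $A_e/(G_{e-1})_e$, where $(G_{e-1})_e=G_{e-1}\cap A_e$. We call $A$ degree-wise finitely generated if all these modules are finitely generated. The complexity of $A$ is $\operatorname{cx}(A)=\inf\{n\in\mathbb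 R_{\ge 0} : c_e(A)=O(n^e) \text{ as } e\to\infty\}$, and $\operatorname{cx}(A)=\infty$ if there is no such $n$. For $k\in\mathbb Z$ let $M_{p,m}(k)$ be the rank over $R$ of the degree $k$ piece of $R[x_1,\dots,x_m]/(x_1^p,\dots,x_m^p)$ (so $M_{p,m}(k)=0$ for $k<0$), and let $U$ be the $(m-r-1)\times(m-r-1)$ matrix with entries $u_{ij}=M_{p,m}(r(p-1)+ip-j)$, $1\le i,j\le m-r-1$. Then $U$ is a primitive matrix (its entries are nonnegative and some positive power of it has only positive entries), and $A$ is degree-wise finitely generated. Moreover, $U$ has a positive real eigenvalue $\lambda$ such that $|\mu|<\lambda$ for every complex eigenvalue $\mu\ne\lambda$ of $U$ (its Perron–Frobenius eigenvalue), and $$\operatorname{cx}(A)=\lambda .$$ -/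

import Mathlib

open scoped DirectSum

/-! ### The complexity of a graded ring `⨁ e, A e` (not necessarily commutative) -/

section Complexity

variable (A : ℕ → Type*) [∀ i, AddCommGroup (A i)] [DirectSum.GRing A]

/-- `G_e(A)`: the subring of `A = ⨁ e, A e` generated by the homogeneous elements of
degree at most `e`. -/
def gradedGen (e : ℕ) : Subring (⨁ i, A i) :=
  Subring.closure {x | ∃ i ≤ e, ∃ a : A i, x = DirectSum.of A i a}

open DirectSum in
/-- `(G_{e-1}(A))_e = G_{e-1}(A) ∩ A_e`, as a left `A_0`-submodule of `A_e`. For `e = 0` the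
truncated subtraction gives `G_0(A)`, the subring generated by `A_0`, which is `A_0 = G_{-1}(A)`. -/
def decomposablePart (e : ℕ) : Submodule (A 0) (A e) where
  carrier := {a | DirectSum.of A e a ∈ gradedGen A (e - 1)}
  add_mem' := by
    intro a b ha hb
    simp only [Set.mem_ofPred_eq, map_add] at *
    exact add_mem ha hb
  zero_mem' := by
    simp only [Set.mem_ofPred_eq, map_zero]
    exact zero_mem _
  smul_mem' := by
    intro c a ha
    simp only [Set.mem_ofPred_eq, DirectSum.of_zero_smul] at *
    exact mul_mem (Subring.subset_closure ⟨0, Nat.zero_le _, c, rfl⟩) ha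

open DirectSum in
/-- `A` is degree-wise finitely generated: each `A_e / (G_{e-1}(A))_e` is finitely generated
over `A_0`. -/
def DegreewiseFG : Prop :=
  ∀ e, Module.Finite (A 0) (A e ⧸ decomposablePart A e)

open DirectSum in
/-- The complexity sequence: `c_e(A)` is the minimal number of generators of
`A_e / (G_{e-1}(A))_e` over `A_0`. (Meaningful for degree-wise finitely generated `A`.) -/
noncomputable def complexitySeq (e : ℕ) : ℕ :=
  (⊤ : Submodule (A 0) (A e ⧸ decomposablePart A e)).spanFinrank

/-- The complexity `cx(A) = inf {n ≥ 0 real | c_e(A) = O(n ^ e)}`, which is `∞` if there is no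
such `n`. -/
noncomputable def complexity : ENNReal :=
  sInf {x : ENNReal | ∃ n : NNReal, x = n ∧
    (fun e : ℕ => (complexitySeq A e : ℝ)) =O[Filter.atTop] fun e : ℕ => (n : ℝ) ^ e}

end Complexity

/-! ### The twisted construction `T` and Veronese subrings

A graded commutative ring is presented by a family `𝒜` of additive subgroups of a commutative
ring `S` with `1 ∈ 𝒜 0` and `𝒜 i * 𝒜 j ⊆ 𝒜 (i + j)`; the graded ring is `⨁ k, 𝒜 k`. -/

section Twisted

variable {S : Type*} [CommRing S] {σ : Type*} [SetLike σ S] [AddSubgroupClass σ S]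

/-- The grading of the `r`-th Veronese subring: the piece of degree `k` of
`V_r (⨁ k, 𝒜 k)` is `𝒜 (r * k)`. -/
def veronese (r : ℕ) (𝒜 : ℕ → σ) : ℕ → σ := fun k => 𝒜 (r * k)

instance veronese.gradedMonoid (r : ℕ) (𝒜 : ℕ → σ) [SetLike.GradedMonoid 𝒜] :
    SetLike.GradedMonoid (veronese r 𝒜) where
  one_mem := SetLike.GradedOne.one_mem (A := 𝒜)
  mul_mem := by
    intro i j a b ha hb
    have h := SetLike.GradedMul.mul_mem (A := 𝒜) ha hb
    rwa [← mul_add] at h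

/-- The piece of degree `e` of `T(ℛ)`, for `ℛ = ⨁ k, 𝒜 k`: it is `ℛ_{p^e - 1}`. -/
def TwistedPiece (p : ℕ) (𝒜 : ℕ → σ) (e : ℕ) : Type _ := 𝒜 (p ^ e - 1)

instance (p : ℕ) (𝒜 : ℕ → σ) (e : ℕ) : AddCommGroup (TwistedPiece p 𝒜 e) :=
  inferInstanceAs (AddCommGroup (𝒜 (p ^ e - 1)))

/-- The element of the ambient ring `S` underlying an element of a piece of `T(ℛ)`. -/
def TwistedPiece.val {p : ℕ} {𝒜 : ℕ → σ} {e : ℕ} (a : TwistedPiece p 𝒜 e) : S :=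
  Subtype.val (p := fun x => x ∈ 𝒜 (p ^ e - 1)) a

theorem TwistedPiece.mk_eq {p : ℕ} {𝒜 : ℕ → σ} (x y : GradedMonoid (TwistedPiece p 𝒜))
    (h : x.1 = y.1) (h' : x.2.val = y.2.val) : x = y := by
  obtain ⟨i, x⟩ := x
  obtain ⟨j, y⟩ := y
  obtain rfl : i = j := h
  obtain rfl : x = y := Subtype.ext h'
  rfl

theorem TwistedPiece.degree_eq (p : ℕ) [Fact p.Prime] (i j : ℕ) :
    (p ^ i - 1) + p ^ i * (p ^ j - 1) = p ^ (i + j) - 1 := by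
  have hp : 0 < p := (Fact.out : p.Prime).pos
  have hi : 1 ≤ p ^ i := Nat.one_le_pow _ _ hp
  have hj : 1 ≤ p ^ j := Nat.one_le_pow _ _ hp
  have h := Nat.mul_le_mul_left (p ^ i) hj
  rw [Nat.mul_sub, pow_add]
  omega

variable (p : ℕ) [Fact p.Prime] (𝒜 : ℕ → σ) [SetLike.GradedMonoid 𝒜]

/-- The twisted multiplication `a ⊛ b = a * b ^ (p ^ i)` for `a` of degree `i`. -/
def TwistedPiece.mul {i j : ℕ} (a : TwistedPiece p 𝒜 i) (b : TwistedPiece p 𝒜 j) :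
    TwistedPiece p 𝒜 (i + j) :=
  ⟨a.val * b.val ^ p ^ i, by
    rw [← TwistedPiece.degree_eq p i j]
    exact SetLike.mul_mem_graded a.2 (SetLike.pow_mem_graded (p ^ i) b.2)⟩

instance : GradedMonoid.GMul (TwistedPiece p 𝒜) := ⟨TwistedPiece.mul p 𝒜⟩

instance : GradedMonoid.GOne (TwistedPiece p 𝒜) :=
  ⟨⟨1, by simpa using SetLike.one_mem_graded 𝒜⟩⟩

/-- `T(ℛ) = ⨁ e, ℛ_{p^e - 1}` with the twisted multiplication is a graded ring. -/
instance TwistedPiece.gRing [CharP S p] : DirectSum.GRing (TwistedPiece p 𝒜) where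
  mul_zero a := Subtype.ext (by
    have : p ≠ 0 := (Fact.out : p.Prime).ne_zero
    change a.val * (0 : S) ^ _ = 0
    rw [zero_pow (pow_ne_zero _ this), mul_zero])
  zero_mul b := Subtype.ext (by
    change (0 : S) * _ = 0
    rw [zero_mul])
  mul_add {i _} a b c := Subtype.ext (by
    change a.val * (b.val + c.val) ^ p ^ i = a.val * b.val ^ p ^ i + a.val * c.val ^ p ^ i
    rw [add_pow_char_pow, mul_add])
  add_mul {i _} a b c := Subtype.ext (by
    change (a.val + b.val) * c.val ^ p ^ i = a.val * c.val ^ p ^ i + b.val * c.val ^ p ^ i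
    rw [add_mul])
  one_mul a := TwistedPiece.mk_eq _ _ (zero_add _) (by
    change (1 : S) * a.2.val ^ p ^ 0 = a.2.val
    rw [pow_zero, pow_one, one_mul])
  mul_one a := TwistedPiece.mk_eq _ _ (add_zero _) (by
    change a.2.val * (1 : S) ^ p ^ a.1 = a.2.val
    rw [one_pow, mul_one])
  mul_assoc a b c := TwistedPiece.mk_eq _ _ (add_assoc _ _ _) (by
    change a.2.val * b.2.val ^ p ^ a.1 * c.2.val ^ p ^ (a.1 + b.1)
      = a.2.val * (b.2.val * c.2.val ^ p ^ b.1) ^ p ^ a.1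
    rw [mul_pow, ← pow_mul, ← pow_add, add_comm b.1, mul_assoc])
  natCast n := ⟨n, by simpa using SetLike.natCast_mem_graded 𝒜 n⟩
  natCast_zero := Subtype.ext Nat.cast_zero
  natCast_succ n := Subtype.ext (Nat.cast_succ n)
  intCast n := ⟨n, by simpa using SetLike.intCast_mem_graded 𝒜 n⟩
  intCast_ofNat n := Subtype.ext (Int.cast_natCast n)
  intCast_negSucc_ofNat n := Subtype.ext (Int.cast_negSucc n)

end Twisted

/-- The graded pieces of `T(V_r(R[x_1, …, x_m]))`, for the standard grading of the
polynomial ring. -/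
abbrev TwistedVeronese (p r m : ℕ) (R : Type*) [CommRing R] : ℕ → Type _ :=
  TwistedPiece p (veronese r (MvPolynomial.homogeneousSubmodule (Fin m) R))

/-! ### The matrix `U` and its Perron–Frobenius eigenvalue -/

section PerronFrobenius

/-- The degree `k` piece of `R[x_1, …, x_m] / (x_1 ^ p, …, x_m ^ p)`. -/
noncomputable def truncatedPiece (p m : ℕ) (R : Type*) [CommRing R] (k : ℕ) :
    Submodule R
      (MvPolynomial (Fin m) R ⧸
        Ideal.span (Set.range fun i : Fin m => (MvPolynomial.X i : MvPolynomial (Fin m) R) ^ p)) :=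
  (MvPolynomial.homogeneousSubmodule (Fin m) R k).map
    (Ideal.Quotient.mkₐ R
      (Ideal.span
        (Set.range fun i : Fin m => (MvPolynomial.X i : MvPolynomial (Fin m) R) ^ p))).toLinearMap

/-- `M_{p,m}(k)`, the rank over `R` of `(R[x_1, …, x_m] / (x_1 ^ p, …, x_m ^ p))_k` for an
integer `k`; it is `0` for `k < 0`. -/
noncomputable def truncatedRank (p m : ℕ) (R : Type*) [CommRing R] (k : ℤ) : ℕ :=
  if 0 ≤ k then Module.finrank R (truncatedPiece p m R k.toNat) else 0

/-- The matrix `U = (u_{ij})`, `u_{ij} = M_{p,m}(r (p - 1) + i p - j)` for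
`1 ≤ i, j ≤ m - r - 1`. The indices of `Fin` start at `0`, hence the shifts by one. -/
noncomputable def matrixU (p r m : ℕ) (R : Type*) [CommRing R] :
    Matrix (Fin (m - r - 1)) (Fin (m - r - 1)) ℝ :=
  Matrix.of fun i j =>
    (truncatedRank p m R
      ((r : ℤ) * ((p : ℤ) - 1) + ((i : ℕ) + 1 : ℤ) * (p : ℤ) - ((j : ℕ) + 1 : ℤ)) : ℝ)

/-- `z` is the unique (complex) eigenvalue of maximal absolute value of the real matrix `U`. -/
def IsPerronFrobeniusEigenvalue {n : ℕ} (U : Matrix (Fin n) (Fin n) ℝ) (z : ℂ) : Prop :=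
  Module.End.HasEigenvalue (Matrix.toLin' (U.map (fun x : ℝ => (x : ℂ)))) z ∧
    ∀ w : ℂ, Module.End.HasEigenvalue (Matrix.toLin' (U.map (fun x : ℝ => (x : ℂ)))) w →
      w ≠ z → ‖w‖ < ‖z‖

end PerronFrobenius

/-! The whole statement reduces to counting monomials. A monomial `x^α` of `A_e` factors through
degrees `i` and `e - i` (`0 < i < e`) exactly when `α = β + p^i γ` with `|β| = r(p^i - 1)`. Every
such `β` dominates `α mod p^i`, and the missing multiple of `p^i` can be taken from the higher
digits; so `x^α` is indecomposable iff `|α mod p^i| + r > r p^i` for all `0 < i < e`. By Frobenius,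
sums create no further decomposables (`mem_decomposablePart_iff`), hence `A_e` modulo decomposables
is free over `A_0` on these monomials and `c_e` is their number.

To count them, read `α` in base `p`. Since `|α| + r = r p^e`, one has `|α mod p^k| + r = p^k (r +
c)`; indecomposability gives `c ≥ 1`, and digits being less than `p` gives `c < m - r`. Passing from
carry `c` to carry `d` needs a vector of `m` digits with sum `r(p-1) + dp - c`, and there are
`u_{dc}` of those. So the carry is the state of a transfer matrix: `c_e = w · U^(e-2) v`, with `v`
counting lowest digits and `w` leading parts.

`U` is primitive because its entries on and next to the diagonal are positive. Perron's theorem then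
gives `c_e = Θ(λ^e)`, whence the complexity is `λ`. -/

/-! ### Perron–Frobenius theory of primitive matrices. -/

section PositiveEigenvector

open Matrix

variable {n : Type*} [Fintype n]

theorem Matrix.mulVec_pos_of_pos {P : Matrix n n ℝ} (hP : ∀ i j, 0 < P i j) {y : n → ℝ}
    (hy : ∀ i, 0 ≤ y i) (hy' : ∃ i, y i ≠ 0) (i : n) : 0 < (P *ᵥ y) i := by
  obtain ⟨j, hj⟩ := hy'
  exact Finset.sum_pos' (fun k _ => mul_nonneg (hP i k).le (hy k))
    ⟨j, Finset.mem_univ j, mul_pos (hP i j) (lt_of_le_of_ne (hy j) (Ne.symm hj))⟩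

theorem Matrix.mulVec_mono_of_nonneg {P : Matrix n n ℝ} (hP : ∀ i j, 0 ≤ P i j) {x y : n → ℝ}
    (h : ∀ i, x i ≤ y i) (i : n) : (P *ᵥ x) i ≤ (P *ᵥ y) i :=
  Finset.sum_le_sum fun j _ => mul_le_mul_of_nonneg_left (h j) (hP i j)

theorem Complex.norm_map_mulVec_le {P : Matrix n n ℝ} (hP : ∀ i j, 0 ≤ P i j) (z : n → ℂ)
    (i : n) : ‖(P.map (fun x : ℝ => (x : ℂ)) *ᵥ z) i‖ ≤ (P *ᵥ fun j => ‖z j‖) i := by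
  refine (norm_sum_le _ _).trans (le_of_eq (Finset.sum_congr rfl fun j _ => ?_))
  change ‖(P i j : ℂ) * z j‖ = P i j * ‖z j‖
  rw [norm_mul, Complex.norm_real, Real.norm_of_nonneg (hP i j)]

variable [DecidableEq n]

theorem Matrix.pow_mulVec_eigenvector {U : Matrix n n ℝ} {l : ℝ} {x : n → ℝ}
    (h : U *ᵥ x = l • x) (k : ℕ) : (U ^ k) *ᵥ x = l ^ k • x := by
  induction k with
  | zero => simp
  | succ k ih => rw [pow_succ, ← mulVec_mulVec, h, mulVec_smul, ih, smul_smul, pow_succ']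

/-- A primitive real matrix has a strictly positive eigenvector (Perron). -/
theorem Matrix.IsPrimitive.exists_pos_eigenvector [Nonempty n] {U : Matrix n n ℝ}
    (hU : U.IsPrimitive) :
    ∃ l : ℝ, 0 < l ∧ ∃ x : n → ℝ, (∀ i, 0 < x i) ∧ U *ᵥ x = l • x := by
  obtain ⟨N, -, hN⟩ := hU.exists_pos_pow
  set B : ℝ := ∑ i, ∑ j, U i j
  have hbound : ∀ x ∈ stdSimplex ℝ n, ∀ ρ : ℝ, (∀ i, ρ * x i ≤ (U *ᵥ x) i) → ρ ≤ B := by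
    intro x hx ρ h
    calc ρ = ∑ i, ρ * x i := by rw [← Finset.mul_sum, hx.2, mul_one]
      _ ≤ ∑ i, (U *ᵥ x) i := Finset.sum_le_sum fun i _ => h i
      _ ≤ B := Finset.sum_le_sum fun i _ => Finset.sum_le_sum fun j _ =>
        mul_le_of_le_one_right (hU.nonneg i j)
          (hx.2 ▸ Finset.single_le_sum (fun k _ => hx.1 k) (Finset.mem_univ j))
  -- Collatz–Wielandt: the eigenvalue is the largest `ρ` with `ρ x ≤ U x` for some `x` in the
  -- simplex. The bound `B` makes the set of such pairs compact.
  set K : Set ((n → ℝ) × ℝ) :=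
    (stdSimplex ℝ n ×ˢ Set.Icc 0 B) ∩ {q | ∀ i, q.2 * q.1 i ≤ (U *ᵥ q.1) i}
  have hK : IsCompact K := by
    refine ((isCompact_stdSimplex ℝ n).prod isCompact_Icc).inter_right ?_
    rw [Set.ofPred_forall]
    refine isClosed_iInter fun i => isClosed_le (by fun_prop) ?_
    simp only [mulVec, dotProduct]
    fun_prop
  have hne : K.Nonempty := by
    obtain ⟨i⟩ := ‹Nonempty n›
    refine ⟨(Pi.single i 1, 0), ⟨single_mem_stdSimplex ℝ i, le_rfl, ?_⟩, fun j => ?_⟩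
    · exact Finset.sum_nonneg fun i _ => Finset.sum_nonneg fun j _ => hU.nonneg i j
    · simpa using hU.nonneg j i
  obtain ⟨⟨x, l⟩, ⟨⟨hx, hl⟩, hle⟩, hmax⟩ := hK.exists_isMaxOn hne continuous_snd.continuousOn
  have hx0 : ∃ i, x i ≠ 0 := by
    by_contra! h
    simpa [h] using hx.2
  have hPx := mulVec_pos_of_pos hN hx.1 hx0
  have heig : U *ᵥ x = l • x := by
    by_contra hcon
    -- If `l x ≤ U x` is not an equality, applying the positive matrix `U ^ N` makes it strict in
    -- every coordinate. Then `l` can be raised by `ε`, against maximality.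
    have hy : ∀ i, 0 < (U ^ N *ᵥ (U *ᵥ x - l • x)) i := by
      refine mulVec_pos_of_pos hN (fun i => sub_nonneg.2 (hle i)) ?_
      by_contra! h
      exact hcon (sub_eq_zero.1 (funext h))
    set z := U ^ N *ᵥ x
    have hz : ∀ i, l * z i < (U *ᵥ z) i := by
      intro i
      have := hy i
      rw [mulVec_sub, mulVec_smul, mulVec_mulVec, ← pow_succ, pow_succ', ← mulVec_mulVec] at this
      exact sub_pos.1 this
    have hs : 0 < ∑ i, z i := Finset.sum_pos (fun i _ => hPx i) Finset.univ_nonempty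
    obtain ⟨i₀, -, hi₀⟩ := Finset.exists_min_image Finset.univ
      (fun i => ((U *ᵥ z) i - l * z i) / z i) Finset.univ_nonempty
    set ε := ((U *ᵥ z) i₀ - l * z i₀) / z i₀
    have hε : 0 < ε := div_pos (sub_pos.2 (hz i₀)) (hPx i₀)
    have hz' : ∀ i, (l + ε) * z i ≤ (U *ᵥ z) i := by
      intro i
      have := (le_div_iff₀ (hPx i)).1 (hi₀ i (Finset.mem_univ i))
      linarith
    have hmem : (∑ i, z i)⁻¹ • z ∈ stdSimplex ℝ n := by
      refine ⟨fun i => mul_nonneg (inv_nonneg.2 hs.le) (hPx i).le, ?_⟩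
      simp only [Pi.smul_apply, smul_eq_mul]
      rw [← Finset.mul_sum, inv_mul_cancel₀ hs.ne']
    have hle' : ∀ i, (l + ε) * ((∑ i, z i)⁻¹ • z) i ≤ (U *ᵥ ((∑ i, z i)⁻¹ • z)) i := by
      intro i
      rw [mulVec_smul]
      simp only [Pi.smul_apply, smul_eq_mul]
      rw [mul_left_comm]
      exact mul_le_mul_of_nonneg_left (hz' i) (inv_nonneg.2 hs.le)
    have := hmax (a := ((∑ i, z i)⁻¹ • z, l + ε))
      ⟨⟨hmem, add_nonneg hl.1 hε.le, hbound _ hmem _ hle'⟩, hle'⟩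
    simp only at this
    have : l + ε ≤ l := this
    linarith
  have hpow := pow_mulVec_eigenvector heig N
  have hxpos : ∀ i, 0 < l ^ N * x i := fun i => by
    have := hPx i
    rw [hpow] at this
    exact this
  have hx' : ∀ i, 0 < x i := fun i =>
    pos_of_mul_pos_right (hxpos i) (pow_nonneg hl.1 N)
  refine ⟨l, lt_of_le_of_ne hl.1 ?_, x, hx', heig⟩
  rintro rfl
  have hUx : U *ᵥ x = 0 := by rw [heig, zero_smul]
  have h2 : U ^ (N + 1) *ᵥ x = 0 := by rw [pow_succ, ← mulVec_mulVec, hUx, mulVec_zero]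
  obtain ⟨i⟩ := ‹Nonempty n›
  have h3 : ∀ j, U i j = 0 := by
    intro j
    have h4 : ∑ j, U i j * x j = 0 := congrFun hUx i
    rw [Finset.sum_eq_zero_iff_of_nonneg
      (fun k _ => mul_nonneg (hU.nonneg i k) (hx' k).le)] at h4
    exact (mul_eq_zero.1 (h4 j (Finset.mem_univ j))).resolve_right (hx' j).ne'
  obtain ⟨M, hM, hMp⟩ := hU.exists_pos_pow
  have h5 := hMp i i
  obtain ⟨M, rfl⟩ := Nat.exists_eq_succ_of_ne_zero hM.ne'
  rw [pow_succ', mul_apply, Finset.sum_eq_zero (fun j _ => by rw [h3 j, zero_mul])] at h5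
  exact lt_irrefl _ h5

end PositiveEigenvector

/-- The eigenvalue of a positive eigenvector of a primitive matrix dominates all others. -/
theorem Matrix.IsPrimitive.isPerronFrobeniusEigenvalue {n : ℕ} {U : Matrix (Fin n) (Fin n) ℝ}
    [Nonempty (Fin n)] (hU : U.IsPrimitive) {l : ℝ} (hl : 0 < l) {x : Fin n → ℝ}
    (hx : ∀ i, 0 < x i) (h : Matrix.mulVec U x = l • x) :
    IsPerronFrobeniusEigenvalue U (l : ℂ) := by
  have hcoe : ∀ (P : Matrix (Fin n) (Fin n) ℝ) (y : Fin n → ℝ),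
      Matrix.mulVec (P.map (fun x : ℝ => (x : ℂ))) (fun i => (y i : ℂ))
        = fun i => ((Matrix.mulVec P y i : ℝ) : ℂ) := by
    intro P y
    funext i
    simp [Matrix.mulVec, dotProduct]
  refine ⟨?_, fun w hw hne => ?_⟩
  · refine Module.End.hasEigenvalue_of_hasEigenvector (x := fun i => (x i : ℂ)) ⟨?_, ?_⟩
    · rw [Module.End.mem_eigenspace_iff, Matrix.toLin'_apply, hcoe, h]
      funext i
      simp
    · intro h0
      obtain ⟨i⟩ := ‹Nonempty (Fin n)›
      have := congrFun h0 i
      simp only [Pi.zero_apply, Complex.ofReal_eq_zero] at this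
      exact (hx i).ne' this
  · obtain ⟨z, hz⟩ := hw.exists_hasEigenvector
    have hz0 := hz.2
    have hz1 : Matrix.mulVec (U.map (fun x : ℝ => (x : ℂ))) z = w • z := by
      have := hz.1
      rwa [Module.End.mem_eigenspace_iff, Matrix.toLin'_apply] at this
    obtain ⟨i₀, -, hi₀⟩ := Finset.exists_max_image Finset.univ
      (fun i => ‖z i‖ / x i) Finset.univ_nonempty
    -- The least `t` with `|z| ≤ t x`; equality holds at `i₀`, where all estimates are made.
    set t := ‖z i₀‖ / x i₀ with ht
    have hle : ∀ i, ‖z i‖ ≤ (t • x) i := fun i =>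
      (div_le_iff₀ (hx i)).1 (hi₀ i (Finset.mem_univ i))
    have heq : ‖z i₀‖ = t * x i₀ := (div_mul_cancel₀ _ (hx i₀).ne').symm
    have htpos : 0 < t := by
      obtain ⟨j, hj⟩ := Function.ne_iff.1 hz0
      exact pos_of_mul_pos_left ((norm_pos_iff.2 hj).trans_le (hle j)) (hx j).le
    obtain ⟨N, hN0, hN⟩ := hU.exists_pos_pow
    have hzN : ∀ k : ℕ, Matrix.mulVec ((U ^ k).map (fun x : ℝ => (x : ℂ))) z = w ^ k • z := by
      intro k
      induction k with
      | zero => simp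
      | succ k ih =>
        have : (U ^ (k + 1)).map (fun x : ℝ => (x : ℂ))
            = (U ^ k).map (fun x : ℝ => (x : ℂ)) * U.map (fun x : ℝ => (x : ℂ)) := by
          rw [pow_succ]
          exact Matrix.map_mul (f := Complex.ofRealHom)
        rw [this, ← Matrix.mulVec_mulVec, hz1, Matrix.mulVec_smul, ih, smul_smul, pow_succ']
    have h1 : ‖w‖ ^ N * ‖z i₀‖ ≤ (Matrix.mulVec (U ^ N) fun j => ‖z j‖) i₀ := by
      have := Complex.norm_map_mulVec_le (fun i j => (hN i j).le) z i₀
      rwa [hzN, Pi.smul_apply, smul_eq_mul, norm_mul, norm_pow] at this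
    have h2 : (Matrix.mulVec (U ^ N) fun j => ‖z j‖) i₀ ≤ l ^ N * ‖z i₀‖ := by
      have := Matrix.mulVec_mono_of_nonneg (fun i j => (hN i j).le) hle i₀
      rw [Matrix.mulVec_smul, Matrix.pow_mulVec_eigenvector h] at this
      simp only [Pi.smul_apply, smul_eq_mul] at this
      rw [heq]
      linarith
    have hzi : 0 < ‖z i₀‖ := heq ▸ mul_pos htpos (hx i₀)
    have hwl : ‖w‖ ≤ l :=
      (pow_le_pow_iff_left₀ (norm_nonneg w) hl.le hN0.ne').1 (le_of_mul_le_mul_right (h1.trans h2) hzi)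
    rw [Complex.norm_real, Real.norm_of_nonneg hl.le]
    -- If `|w| = l`, every estimate at row `i₀` is an equality. Positivity of that row of `U ^ N`
    -- forces `|z| = t x`, and equality in the triangle inequality gives all `z j` the argument of
    -- `S`. So `z` is a complex multiple of `x` and `w = l`.
    refine lt_of_le_of_ne hwl fun hwl' => hne ?_
    have h3 : (Matrix.mulVec (U ^ N) fun j => ‖z j‖) i₀ = l ^ N * ‖z i₀‖ :=
      le_antisymm h2 (hwl' ▸ h1)
    have hnorm : ∀ j, ‖z j‖ = t * x j := by
      have h4 : ∑ j, (U ^ N) i₀ j * (t * x j - ‖z j‖) = 0 := by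
        have h5 : (Matrix.mulVec (U ^ N) (t • x)) i₀ = l ^ N * ‖z i₀‖ := by
          rw [Matrix.mulVec_smul, Matrix.pow_mulVec_eigenvector h, heq]
          simp only [Pi.smul_apply, smul_eq_mul]
          ring
        have h6 := h5.trans h3.symm
        simp only [Matrix.mulVec, dotProduct, Pi.smul_apply, smul_eq_mul] at h6
        simp only [mul_sub, Finset.sum_sub_distrib]
        rw [h6, sub_self]
      intro j
      have := (mul_eq_zero.1 ((Finset.sum_eq_zero_iff_of_nonneg (fun j _ =>
        mul_nonneg (hN i₀ j).le (sub_nonneg.2 (hle j)))).1 h4 j (Finset.mem_univ j))).resolve_left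
        (hN i₀ j).ne'
      exact (sub_eq_zero.1 this).symm
    set S : ℂ := w ^ N * z i₀ with hS
    have hSsum : S = ∑ j, ((U ^ N) i₀ j : ℂ) * z j := by
      have := congrFun (hzN N) i₀
      simpa [Matrix.mulVec, dotProduct] using this.symm
    have hSn : ‖S‖ = ∑ j, (U ^ N) i₀ j * ‖z j‖ := by
      rw [hS, norm_mul, norm_pow, hwl', ← h3]
      rfl
    have hS0 : S ≠ 0 := by
      rw [← norm_pos_iff, hS, norm_mul, norm_pow, hwl']
      positivity
    clear_value S
    have hray : ∀ j, (S * (starRingEnd ℂ) (z j)).re = ‖S‖ * ‖z j‖ := by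
      have h4 : ∑ j, (U ^ N) i₀ j * (‖S‖ * ‖z j‖ - (S * (starRingEnd ℂ) (z j)).re) = 0 := by
        have h5 : (S * (starRingEnd ℂ) S).re = ‖S‖ * ‖S‖ := by
          rw [Complex.mul_conj, Complex.ofReal_re, Complex.normSq_eq_norm_sq, sq]
        have h6 : (S * (starRingEnd ℂ) S).re
            = ∑ j, (U ^ N) i₀ j * (S * (starRingEnd ℂ) (z j)).re := by
          conv_lhs => rw [show (starRingEnd ℂ) S = ∑ j, ((U ^ N) i₀ j : ℂ) * (starRingEnd ℂ) (z j)
            by rw [hSsum]; simp]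
          rw [Finset.mul_sum, Complex.re_sum]
          refine Finset.sum_congr rfl fun j _ => ?_
          rw [mul_left_comm, Complex.re_ofReal_mul]
        have h7 : ‖S‖ * ‖S‖ = ∑ j, (U ^ N) i₀ j * (‖S‖ * ‖z j‖) := by
          simp only [mul_left_comm _ ‖S‖, ← Finset.mul_sum]
          rw [← hSn]
        simp only [mul_sub, Finset.sum_sub_distrib]
        rw [← h7, ← h6, h5, sub_self]
      intro j
      have := (mul_eq_zero.1 ((Finset.sum_eq_zero_iff_of_nonneg (fun j _ =>
        mul_nonneg (hN i₀ j).le (sub_nonneg.2 ((Complex.re_le_norm _).trans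
          (by rw [norm_mul, RCLike.norm_conj]))))).1 h4 j (Finset.mem_univ j))).resolve_left
        (hN i₀ j).ne'
      linarith
    have hzx : ∀ j, z j = (S / ‖S‖ * t) * x j := by
      intro j
      have h5 : S * (starRingEnd ℂ) (z j) = (‖S * (starRingEnd ℂ) (z j)‖ : ℂ) :=
        Complex.eq_coe_norm_of_nonneg (Complex.re_eq_norm.1
          ((hray j).trans (by rw [norm_mul, RCLike.norm_conj])))
      have h6 := congrArg (starRingEnd ℂ) h5
      rw [norm_mul, RCLike.norm_conj, map_mul, Complex.conj_conj, Complex.conj_ofReal,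
        hnorm j] at h6
      have h7 : S * (starRingEnd ℂ) S = (‖S‖ : ℂ) ^ 2 := by
        rw [Complex.mul_conj, Complex.normSq_eq_norm_sq, Complex.ofReal_pow]
      have h8 : (‖S‖ : ℂ) ≠ 0 := by simpa using hS0
      push_cast at h6
      field_simp
      refine mul_left_cancel₀ h8 ?_
      linear_combination S * h6 - z j * h7
    have hw : w * z i₀ = l * z i₀ := by
      have h8 : z = (S / ‖S‖ * t : ℂ) • fun j => (x j : ℂ) := funext hzx
      have h9 := congrFun hz1 i₀
      rw [h8, Matrix.mulVec_smul, hcoe, h] at h9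
      rw [hzx]
      simp only [Pi.smul_apply, smul_eq_mul, Complex.ofReal_mul] at h9
      rw [← h9]
      ring
    exact mul_right_cancel₀ (norm_pos_iff.1 hzi) hw

/-! ### The numbers `M_{p,m}(k)` as counts of bounded exponent vectors. -/

section TruncatedRank

/-- The exponents of the monomials of degree `k` in `m` variables, all exponents being `< q`. -/
def boundedExponents (q m : ℕ) (k : ℤ) : Finset (Fin m → ℕ) :=
  (Fintype.piFinset fun _ => Finset.range q).filter fun γ => ((∑ j, γ j : ℕ) : ℤ) = k

theorem mem_boundedExponents {q m : ℕ} {k : ℤ} {γ : Fin m → ℕ} :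
    γ ∈ boundedExponents q m k ↔ (∀ j, γ j < q) ∧ ((∑ j, γ j : ℕ) : ℤ) = k := by
  simp [boundedExponents]

variable (p m : ℕ) (R : Type*) [CommRing R]

theorem mem_span_X_pow_iff {f : MvPolynomial (Fin m) R} :
    f ∈ Ideal.span (Set.range fun i : Fin m => (MvPolynomial.X i : MvPolynomial (Fin m) R) ^ p) ↔
      ∀ α ∈ f.support, ∃ i, p ≤ α i := by
  have : (Set.range fun i : Fin m => (MvPolynomial.X i : MvPolynomial (Fin m) R) ^ p)
      = (fun s => MvPolynomial.monomial s (1 : R)) '' Set.range fun i => Finsupp.single i p := by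
    rw [← Set.range_comp]
    congr 1
    funext i
    exact MvPolynomial.X_pow_eq_monomial
  rw [this, MvPolynomial.mem_ideal_span_monomial_image]
  simp [Finsupp.single_le_iff]

variable {m R} in
theorem MvPolynomial.IsHomogeneous.sum_exponents_eq {f : MvPolynomial (Fin m) R} {k : ℕ}
    (hf : f.IsHomogeneous k) {α : Fin m →₀ ℕ} (hα : f.coeff α ≠ 0) : ∑ j, α j = k := by
  rw [← Finsupp.degree_eq_sum, Finsupp.degree_eq_weight_one]
  exact hf hα

/-- The ideal is monomial, so the classes of the monomials with all exponents below `p` form a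
basis. -/
theorem finrank_truncatedPiece [Nontrivial R] (k : ℕ) :
    Module.finrank R (truncatedPiece p m R k) = (boundedExponents p m k).card := by
  set I := Ideal.span
    (Set.range fun i : Fin m => (MvPolynomial.X i : MvPolynomial (Fin m) R) ^ p) with hI
  set e : (Fin m → ℕ) → (Fin m →₀ ℕ) :=
    fun γ => Finsupp.equivFunOnFinite.symm γ with he
  have hinj : Function.Injective e := by
    rw [he]
    exact Finsupp.equivFunOnFinite.symm.injective
  set b : boundedExponents p m k → MvPolynomial (Fin m) R ⧸ I :=
    fun γ => Ideal.Quotient.mkₐ R I (MvPolynomial.monomial (e γ.1) 1) with hb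
  have hli : LinearIndependent R b := by
    rw [Fintype.linearIndependent_iff]
    intro g hg γ
    by_contra hne
    have hsum : Ideal.Quotient.mkₐ R I (∑ γ, g γ • MvPolynomial.monomial (e γ.1) 1) = 0 := by
      simpa [hb] using hg
    have hmem : ∑ γ, g γ • MvPolynomial.monomial (e γ.1) (1 : R) ∈ I :=
      Ideal.Quotient.eq_zero_iff_mem.1 hsum
    rw [hI, mem_span_X_pow_iff] at hmem
    obtain ⟨i, hi⟩ := hmem (e γ.1) (by
      classical
      rw [MvPolynomial.mem_support_iff, MvPolynomial.coeff_sum]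
      simp only [MvPolynomial.coeff_smul, MvPolynomial.coeff_monomial, hinj.eq_iff,
        Subtype.coe_inj, smul_eq_mul, mul_ite, mul_one, mul_zero, Finset.sum_ite_eq',
        Finset.mem_univ, if_true]
      exact hne)
    exact absurd ((mem_boundedExponents.1 γ.2).1 i) (not_lt.2 hi)
  have hspan : truncatedPiece p m R k = Submodule.span R (Set.range b) := by
    apply le_antisymm
    · rintro _ ⟨f, hf, rfl⟩
      change Ideal.Quotient.mkₐ R I f ∈ _
      rw [f.as_sum, map_sum]
      refine Submodule.sum_mem _ fun α hα => ?_
      by_cases hα' : ∃ i, p ≤ α i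
      · have : MvPolynomial.monomial α (f.coeff α) ∈ I := by
          rw [hI, mem_span_X_pow_iff]
          intro β hβ
          rwa [Finset.mem_singleton.1 (MvPolynomial.support_monomial_subset hβ)]
        have h0 : Ideal.Quotient.mkₐ R I (MvPolynomial.monomial α (f.coeff α)) = 0 :=
          Ideal.Quotient.eq_zero_iff_mem.2 this
        rw [h0]
        exact zero_mem _
      · push Not at hα'
        have hdeg : ∑ j, α j = k := MvPolynomial.IsHomogeneous.sum_exponents_eq
          ((MvPolynomial.mem_homogeneousSubmodule _ _).1 hf) (MvPolynomial.mem_support_iff.1 hα)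
        have : MvPolynomial.monomial α (f.coeff α)
            = f.coeff α • MvPolynomial.monomial α (1 : R) := by
          rw [MvPolynomial.smul_monomial, smul_eq_mul, mul_one]
        rw [this, map_smul]
        refine Submodule.smul_mem _ _ (Submodule.subset_span
          ⟨⟨α, mem_boundedExponents.2 ⟨hα', by exact_mod_cast hdeg⟩⟩, ?_⟩)
        simp [hb, he]
    · rw [Submodule.span_le]
      rintro _ ⟨γ, rfl⟩
      refine ⟨MvPolynomial.monomial (e γ.1) 1, ?_, rfl⟩
      refine MvPolynomial.isHomogeneous_monomial _ ?_
      rw [Finsupp.degree_eq_sum]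
      exact_mod_cast (mem_boundedExponents.1 γ.2).2
  rw [hspan, finrank_span_eq_card hli, Fintype.card_coe]

theorem truncatedRank_eq_card [Nontrivial R] (k : ℤ) :
    truncatedRank p m R k = (boundedExponents p m k).card := by
  rw [truncatedRank]
  split_ifs with hk
  · rw [finrank_truncatedPiece, Int.toNat_of_nonneg hk]
  · symm
    rw [Finset.card_eq_zero, Finset.eq_empty_iff_forall_notMem]
    intro γ hγ
    have := (mem_boundedExponents.1 hγ).2
    omega

/-- Greedy filling: the first variable takes as much of `k` as `q - 1` allows. -/
theorem boundedExponents_nonempty {q m : ℕ} (hq : 0 < q) {k : ℤ} (h0 : 0 ≤ k)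
    (hk : k ≤ m * (q - 1 : ℤ)) : (boundedExponents q m k).Nonempty := by
  lift k to ℕ using h0
  induction m generalizing k with
  | zero =>
    exact ⟨0, mem_boundedExponents.2 ⟨fun j => j.elim0, by simp at hk ⊢; omega⟩⟩
  | succ m ih =>
    obtain ⟨γ, hγ⟩ := ih (k - min k (q - 1)) (by
      rcases le_total k (q - 1) with h | h
      · rw [min_eq_left h, Nat.sub_self]
        exact mul_nonneg (by positivity) (by omega)
      · rw [min_eq_right h, Nat.cast_sub h, Nat.cast_sub (by omega)]
        push_cast at hk ⊢
        linarith)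
    rw [mem_boundedExponents] at hγ
    refine ⟨Fin.cons (min k (q - 1)) γ, mem_boundedExponents.2 ⟨fun j => ?_, ?_⟩⟩
    · refine Fin.cases ?_ (fun j => ?_) j
      · simp only [Fin.cons_zero]
        omega
      · simpa using hγ.1 j
    · rw [Fin.sum_univ_succ]
      simp only [Fin.cons_zero, Fin.cons_succ]
      have := hγ.2
      omega

end TruncatedRank

/-! ### Growth of powers of a primitive matrix. -/

section Growth

open Matrix Filter Asymptotics

/-- The entries of the powers of a primitive matrix grow like the powers of its Perron–Frobenius
eigenvalue. -/
theorem Matrix.IsPrimitive.isTheta_dotProduct_pow_mulVec {n : Type*} [Fintype n] [DecidableEq n]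
    [Nonempty n] {U : Matrix n n ℝ} (hU : U.IsPrimitive) {l : ℝ} (hl : 0 < l) {x : n → ℝ}
    (hx : ∀ i, 0 < x i) (h : U *ᵥ x = l • x) {v w : n → ℝ} (hv : ∀ i, 0 ≤ v i)
    (hv' : ∃ i, v i ≠ 0) (hw : ∀ i, 0 ≤ w i) (hw' : ∃ i, w i ≠ 0) :
    (fun k : ℕ => w ⬝ᵥ (U ^ k *ᵥ v)) =Θ[atTop] fun k : ℕ => l ^ k := by
  have hUk := fun k => pow_apply_nonneg hU.nonneg k
  have hwx : 0 < w ⬝ᵥ x := by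
    obtain ⟨i, hi⟩ := hw'
    exact Finset.sum_pos' (fun j _ => mul_nonneg (hw j) (hx j).le)
      ⟨i, Finset.mem_univ i, mul_pos (lt_of_le_of_ne (hw i) (Ne.symm hi)) (hx i)⟩
  have hnn : ∀ k, 0 ≤ w ⬝ᵥ (U ^ k *ᵥ v) := fun k =>
    Finset.sum_nonneg fun i _ => mul_nonneg (hw i)
      (Finset.sum_nonneg fun j _ => mul_nonneg (hUk k i j) (hv j))
  constructor
  · obtain ⟨i₀, -, hi₀⟩ := Finset.exists_max_image Finset.univ
      (fun i => v i / x i) Finset.univ_nonempty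
    set t := v i₀ / x i₀
    have hle : ∀ i, v i ≤ (t • x) i := fun i =>
      (div_le_iff₀ (hx i)).1 (hi₀ i (Finset.mem_univ i))
    refine IsBigO.of_bound (t * (w ⬝ᵥ x)) (Eventually.of_forall fun k => ?_)
    rw [Real.norm_of_nonneg (hnn k), Real.norm_of_nonneg (pow_nonneg hl.le k)]
    calc w ⬝ᵥ (U ^ k *ᵥ v) ≤ w ⬝ᵥ (U ^ k *ᵥ (t • x)) :=
          Finset.sum_le_sum fun i _ => mul_le_mul_of_nonneg_left
            (mulVec_mono_of_nonneg (hUk k) hle i) (hw i)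
      _ = t * (w ⬝ᵥ x) * l ^ k := by
          rw [mulVec_smul, pow_mulVec_eigenvector h, dotProduct_smul, dotProduct_smul]
          simp only [smul_eq_mul]
          ring
  -- `v` may have zero entries, but `U ^ N v` has none and dominates a positive multiple of the
  -- eigenvector. The delay of `N` steps costs the factor `l ^ N`.
  · obtain ⟨N, -, hN⟩ := hU.exists_pos_pow
    have hpos := mulVec_pos_of_pos hN hv hv'
    obtain ⟨i₀, -, hi₀⟩ := Finset.exists_min_image Finset.univ
      (fun i => (U ^ N *ᵥ v) i / x i) Finset.univ_nonempty
    set s := (U ^ N *ᵥ v) i₀ / x i₀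
    have hs : 0 < s := div_pos (hpos i₀) (hx i₀)
    have hle : ∀ i, (s • x) i ≤ (U ^ N *ᵥ v) i := fun i =>
      (le_div_iff₀ (hx i)).1 (hi₀ i (Finset.mem_univ i))
    refine IsBigO.of_bound (l ^ N / (s * (w ⬝ᵥ x))) ?_
    filter_upwards [eventually_ge_atTop N] with k hk
    obtain ⟨k, rfl⟩ := Nat.exists_eq_add_of_le' hk
    rw [Real.norm_of_nonneg (hnn _), Real.norm_of_nonneg (pow_nonneg hl.le _), div_mul_eq_mul_div,
      le_div_iff₀ (mul_pos hs hwx)]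
    have : s * (w ⬝ᵥ x) * l ^ k ≤ w ⬝ᵥ (U ^ (k + N) *ᵥ v) :=
      calc s * (w ⬝ᵥ x) * l ^ k = w ⬝ᵥ (U ^ k *ᵥ (s • x)) := by
            rw [mulVec_smul, pow_mulVec_eigenvector h, dotProduct_smul, dotProduct_smul]
            simp only [smul_eq_mul]
            ring
        _ ≤ w ⬝ᵥ (U ^ k *ᵥ (U ^ N *ᵥ v)) :=
            Finset.sum_le_sum fun i _ => mul_le_mul_of_nonneg_left
              (mulVec_mono_of_nonneg (hUk k) hle i) (hw i)
        _ = _ := by rw [mulVec_mulVec, ← pow_add]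
    calc l ^ (k + N) * (s * (w ⬝ᵥ x)) = l ^ N * (s * (w ⬝ᵥ x) * l ^ k) := by ring
      _ ≤ _ := mul_le_mul_of_nonneg_left this (pow_nonneg hl.le N)

end Growth

/-! ### Primitivity of `U`. -/

section Primitive

variable (p r m : ℕ) (R : Type*) [CommRing R] [Nontrivial R]

theorem matrixU_apply (i j : Fin (m - r - 1)) : matrixU p r m R i j =
    (boundedExponents p m ((r : ℤ) * ((p : ℤ) - 1) + ((i : ℕ) + 1 : ℤ) * (p : ℤ)
      - ((j : ℕ) + 1 : ℤ))).card := by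
  rw [matrixU, Matrix.of_apply, truncatedRank_eq_card]

/-- For indices at distance at most one, `p ≥ 2` places the degree between `0` and `(r + i + 2)(p -
1) ≤ m (p - 1)`, with `i` counted from zero. -/
theorem matrixU_pos (hp : 2 ≤ p) {i j : Fin (m - r - 1)} (h₁ : (i : ℕ) ≤ j + 1)
    (h₂ : (j : ℕ) ≤ i + 1) : 0 < matrixU p r m R i j := by
  rw [matrixU_apply, Nat.cast_pos, Finset.card_pos]
  obtain ⟨q, rfl⟩ := Nat.exists_eq_add_of_le hp
  have hi := i.2
  obtain ⟨d, hd⟩ : ∃ d, m = r + (i : ℕ) + 2 + d := ⟨m - (r + i + 2), by omega⟩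
  refine boundedExponents_nonempty (by omega) ?_ ?_
  · push_cast
    nlinarith [mul_nonneg (Nat.cast_nonneg (α := ℤ) r) (Nat.cast_nonneg (α := ℤ) q),
      mul_nonneg (Nat.cast_nonneg (α := ℤ) (i : ℕ)) (Nat.cast_nonneg (α := ℤ) q)]
  · have hd' : (m : ℤ) = r + (i : ℕ) + 2 + d := by exact_mod_cast hd
    rw [hd']
    push_cast
    nlinarith [mul_nonneg (Nat.cast_nonneg (α := ℤ) d) (Nat.cast_nonneg (α := ℤ) q)]

/-- A walk that may stay or move by one reaches in `k` steps every index at distance at most `k`;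
`n` steps reach them all. -/
theorem isPrimitive_of_tridiagonal {n : ℕ} {U : Matrix (Fin n) (Fin n) ℝ} (hn : 0 < n)
    (h0 : ∀ i j, 0 ≤ U i j) (h : ∀ i j : Fin n, (i : ℕ) ≤ j + 1 → (j : ℕ) ≤ i + 1 → 0 < U i j) :
    U.IsPrimitive := by
  have key : ∀ k : ℕ, ∀ i j : Fin n, (i : ℕ) ≤ j + k → (j : ℕ) ≤ i + k → 0 < (U ^ k) i j := by
    intro k
    induction k with
    | zero =>
      intro i j h₁ h₂
      obtain rfl : i = j := Fin.ext (by omega)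
      simp
    | succ k ih =>
      intro i j h₁ h₂
      obtain ⟨l, hl⟩ : ∃ l : Fin n, ((i : ℕ) ≤ l + k ∧ (l : ℕ) ≤ i + k) ∧
          ((l : ℕ) ≤ j + 1 ∧ (j : ℕ) ≤ l + 1) := by
        rcases lt_trichotomy (i : ℕ) j with hij | hij | hij
        · exact ⟨⟨j - 1, by omega⟩, by simp only; omega⟩
        · exact ⟨j, by omega⟩
        · exact ⟨⟨j + 1, by omega⟩, by simp only; omega⟩
      rw [pow_succ, Matrix.mul_apply]
      exact Finset.sum_pos'
        (fun l _ => mul_nonneg (Matrix.pow_apply_nonneg h0 k i l) (h0 l j))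
        ⟨l, Finset.mem_univ l, mul_pos (ih i l hl.1.1 hl.1.2) (h l j hl.2.1 hl.2.2)⟩
  exact ⟨h0, n, hn, fun i j => key n i j (by omega) (by omega)⟩

theorem matrixU_isPrimitive (hp : 2 ≤ p) (hm : r + 1 < m) : (matrixU p r m R).IsPrimitive :=
  isPrimitive_of_tridiagonal (by omega) (fun _ _ => Nat.cast_nonneg _)
    fun _ _ h₁ h₂ => matrixU_pos p r m R hp h₁ h₂

end Primitive

/-! ### Base-`p` digits, carries and the transfer matrix. -/

section Counting

/-- Counting through the decomposition `α = β + q γ` with `β < q`. -/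
theorem Finset.card_eq_sum_mod_div {m q : ℕ} (hq : 0 < q) {ι : Type*} [Fintype ι]
    {T : Finset (Fin m → ℕ)} {S Γ : ι → Finset (Fin m → ℕ)} (hS : ∀ c, ∀ β ∈ S c, ∀ j, β j < q)
    (hdisj : ∀ c c' β, β ∈ S c → β ∈ S c' → c = c')
    (hT : ∀ α : Fin m → ℕ, α ∈ T ↔ ∃ c, (fun j => α j % q) ∈ S c ∧ (fun j => α j / q) ∈ Γ c) :
    T.card = ∑ c, (S c).card * (Γ c).card := by
  have hmod : ∀ c, ∀ β ∈ S c, ∀ γ : Fin m → ℕ, (fun j => (β j + q * γ j) % q) = β :=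
    fun c β hβ γ => funext fun j => by
      rw [Nat.add_mul_mod_self_left, Nat.mod_eq_of_lt (hS c β hβ j)]
  have hdiv : ∀ c, ∀ β ∈ S c, ∀ γ : Fin m → ℕ, (fun j => (β j + q * γ j) / q) = γ :=
    fun c β hβ γ => funext fun j => by
      rw [Nat.add_mul_div_left _ _ hq, Nat.div_eq_of_lt (hS c β hβ j), zero_add]
  simp only [← Finset.card_product]
  rw [← Finset.card_sigma]
  symm
  refine Finset.card_bij (fun x _ j => x.2.1 j + q * x.2.2 j) ?_ ?_ ?_
  · rintro ⟨c, β, γ⟩ h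
    obtain ⟨hβ, hγ⟩ := Finset.mem_product.1 (Finset.mem_sigma.1 h).2
    refine (hT _).2 ⟨c, ?_, ?_⟩
    · simpa only [hmod c β hβ γ] using hβ
    · simpa only [hdiv c β hβ γ] using hγ
  · rintro ⟨c, β, γ⟩ h ⟨c', β', γ'⟩ h' heq
    obtain ⟨hβ, hγ⟩ := Finset.mem_product.1 (Finset.mem_sigma.1 h).2
    obtain ⟨hβ', hγ'⟩ := Finset.mem_product.1 (Finset.mem_sigma.1 h').2
    simp only at hβ hβ' hγ hγ' heq
    have h1 : β = β' := by
      rw [← hmod c β hβ γ, ← hmod c' β' hβ' γ']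
      funext j
      rw [congrFun heq j]
    have h2 : γ = γ' := by
      rw [← hdiv c β hβ γ, ← hdiv c' β' hβ' γ']
      funext j
      rw [congrFun heq j]
    subst h1 h2
    obtain rfl := hdisj c c' β hβ hβ'
    rfl
  · intro α hα
    obtain ⟨c, hβ, hγ⟩ := (hT α).1 hα
    exact ⟨⟨c, _, _⟩, Finset.mem_sigma.2 ⟨Finset.mem_univ c, Finset.mem_product.2 ⟨hβ, hγ⟩⟩,
      funext fun j => Nat.mod_add_div (α j) q⟩

variable (p r m : ℕ)

open Classical in
/-- The exponents of the monomials of degree `r (p ^ e - 1)` which are not products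
`a * b ^ (p ^ i)` of monomials of degrees `r (p ^ i - 1)` and `r (p ^ (e - i) - 1)`,
`0 < i < e`. -/
noncomputable def indecomposableExponents (e : ℕ) : Finset (Fin m → ℕ) :=
  (Finset.piAntidiag Finset.univ (r * (p ^ e - 1))).filter fun α =>
    ∀ i, 1 ≤ i → i < e → r * p ^ i < ∑ j, α j % p ^ i + r

open Classical in
/-- The truncations modulo `p ^ k` of indecomposable exponents, with carry `c` at `p ^ k`. -/
noncomputable def carryExponents (k c : ℕ) : Finset (Fin m → ℕ) :=
  (Fintype.piFinset fun _ => Finset.range (p ^ k)).filter fun β =>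
    ∑ j, β j + r = p ^ k * (r + c) ∧ ∀ i, 1 ≤ i → i < k → r * p ^ i < ∑ j, β j % p ^ i + r

/-- The possible leading parts of indecomposable exponents, given the carry `c`. -/
def leadingExponents (c : ℕ) : Finset (Fin m → ℕ) :=
  (Fintype.piFinset fun _ => Finset.range (r * p + 1)).filter fun γ => ∑ j, γ j + r + c = r * p

variable {p r m}

theorem mem_indecomposableExponents (hp : 0 < p) {e : ℕ} {α : Fin m → ℕ} :
    α ∈ indecomposableExponents p r m e ↔ ∑ j, α j + r = r * p ^ e ∧
      ∀ i, 1 ≤ i → i < e → r * p ^ i < ∑ j, α j % p ^ i + r := by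
  have : r ≤ r * p ^ e := Nat.le_mul_of_pos_right r (pow_pos hp e)
  simp only [indecomposableExponents, Finset.mem_filter, Finset.mem_piAntidiag, Finset.mem_univ,
    implies_true, and_true, Nat.mul_sub, mul_one]
  exact and_congr_left fun _ => eq_tsub_iff_add_eq_of_le this

theorem mem_carryExponents {k c : ℕ} {β : Fin m → ℕ} :
    β ∈ carryExponents p r m k c ↔ (∀ j, β j < p ^ k) ∧ ∑ j, β j + r = p ^ k * (r + c) ∧
      ∀ i, 1 ≤ i → i < k → r * p ^ i < ∑ j, β j % p ^ i + r := by
  simp [carryExponents]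

theorem mem_leadingExponents {c : ℕ} {γ : Fin m → ℕ} :
    γ ∈ leadingExponents p r m c ↔ ∑ j, γ j + r + c = r * p := by
  simp only [leadingExponents, Finset.mem_filter, Fintype.mem_piFinset, Finset.mem_range,
    and_iff_right_iff_imp]
  intro h j
  have := Finset.single_le_sum (f := γ) (fun _ _ => Nat.zero_le _) (Finset.mem_univ j)
  omega

theorem sum_mod_add_sum_div (q : ℕ) (α : Fin m → ℕ) :
    ∑ j, α j = ∑ j, α j % q + q * ∑ j, α j / q := by
  rw [Finset.mul_sum, ← Finset.sum_add_distrib]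
  exact Finset.sum_congr rfl fun j _ => (Nat.mod_add_div _ _).symm

/-- Each `β j + 1 ≤ p ^ k`, so `|β| + r < |β| + m ≤ m p ^ k`. -/
theorem carry_lt (hr : r < m) {k t : ℕ} {β : Fin m → ℕ} (hβ : ∀ j, β j < p ^ k)
    (h : ∑ j, β j + r = p ^ k * t) : t < m := by
  have h1 : ∑ j, (β j + 1) ≤ ∑ _j : Fin m, p ^ k := Finset.sum_le_sum fun j _ => hβ j
  rw [Finset.sum_add_distrib] at h1
  simp only [Finset.sum_const, Finset.card_univ, Fintype.card_fin, smul_eq_mul, mul_one] at h1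
  have : p ^ k * t < p ^ k * m := by
    rw [mul_comm _ m]
    omega
  exact lt_of_mul_lt_mul_left this (Nat.zero_le _)

theorem forall_sum_mod_iff {k : ℕ} (α : Fin m → ℕ) :
    (∀ i, 1 ≤ i → i < k → r * p ^ i < ∑ j, (α j % p ^ k) % p ^ i + r) ↔
      ∀ i, 1 ≤ i → i < k → r * p ^ i < ∑ j, α j % p ^ i + r := by
  refine forall_congr' fun i => imp_congr_right fun _ => imp_congr_right fun hi => ?_
  simp only [Nat.mod_mod_of_dvd _ (pow_dvd_pow p hi.le)]

/-- Reducing `h` modulo `p ^ k` gives `|α mod p^k| + r = p^k t`. The condition at `i = k` says `r <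
t`, and `carry_lt` says `t < m`; the carry is `t - r`, shifted by one to index `Fin`. -/
theorem exists_carry (hp : 0 < p) (hr : r < m) {k s : ℕ} (hk : 1 ≤ k) {α : Fin m → ℕ}
    (h : ∑ j, α j + r = p ^ k * s)
    (h' : ∀ i, 1 ≤ i → i < k + 1 → r * p ^ i < ∑ j, α j % p ^ i + r) :
    ∃ c : Fin (m - r - 1), (fun j => α j % p ^ k) ∈ carryExponents p r m k (c + 1) := by
  have hq : 0 < p ^ k := pow_pos hp k
  obtain ⟨t, ht⟩ : p ^ k ∣ ∑ j, α j % p ^ k + r := by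
    have h1 : p ^ k ∣ (∑ j, α j % p ^ k + r) + p ^ k * ∑ j, α j / p ^ k :=
      ⟨s, by rw [← h, sum_mod_add_sum_div (p ^ k) α]; ring⟩
    exact (Nat.dvd_add_left (dvd_mul_right _ _)).1 h1
  have hlt : ∀ j, α j % p ^ k < p ^ k := fun j => Nat.mod_lt _ hq
  have htm := carry_lt hr hlt ht
  have hrt : r < t := by
    have := h' k hk (Nat.lt_succ_self k)
    rw [ht, mul_comm] at this
    exact lt_of_mul_lt_mul_left this (Nat.zero_le _)
  refine ⟨⟨t - r - 1, by omega⟩, mem_carryExponents.2 ⟨hlt, ?_, ?_⟩⟩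
  · rw [ht]
    congr 1
    simp only
    omega
  · exact (forall_sum_mod_iff α).2 fun i hi hik => h' i hi (by omega)

theorem carryExponents_disjoint (hp : 0 < p) {k : ℕ} (c c' : Fin (m - r - 1)) (β : Fin m → ℕ)
    (h : β ∈ carryExponents p r m k (c + 1)) (h' : β ∈ carryExponents p r m k (c' + 1)) :
    c = c' := by
  have h1 := (mem_carryExponents.1 h).2.1.symm.trans (mem_carryExponents.1 h').2.1
  have := Nat.eq_of_mul_eq_mul_left (pow_pos hp k) h1
  exact Fin.ext (by omega)

/-- The new condition, at `i = k`, is precisely that the carry `c + 1` is positive. -/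
theorem forall_of_mem_carryExponents (hp : 0 < p) {k c : ℕ} {α : Fin m → ℕ}
    (h : (fun j => α j % p ^ k) ∈ carryExponents p r m k (c + 1)) :
    ∀ i, 1 ≤ i → i < k + 1 → r * p ^ i < ∑ j, α j % p ^ i + r := by
  intro i hi hik
  rcases Nat.lt_succ_iff_lt_or_eq.1 hik with hik | rfl
  · exact (forall_sum_mod_iff α).1 (mem_carryExponents.1 h).2.2 i hi hik
  · rw [(mem_carryExponents.1 h).2.1, mul_comm]
    exact mul_lt_mul_of_pos_left (by omega) (pow_pos hp i)

theorem card_indecomposableExponents_succ (hp : 0 < p) (hr : r < m) {k : ℕ} (hk : 1 ≤ k) :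
    (indecomposableExponents p r m (k + 1)).card = ∑ c : Fin (m - r - 1),
      (carryExponents p r m k (c + 1)).card * (leadingExponents p r m (c + 1)).card := by
  have hq : 0 < p ^ k := pow_pos hp k
  refine Finset.card_eq_sum_mod_div hq (fun c β hβ => (mem_carryExponents.1 hβ).1)
    (carryExponents_disjoint hp) fun α => ?_
  have key : ∀ c : Fin (m - r - 1), (fun j => α j % p ^ k) ∈ carryExponents p r m k (c + 1) →
      ((fun j => α j / p ^ k) ∈ leadingExponents p r m (c + 1) ↔
        ∑ j, α j + r = r * p ^ (k + 1)) := by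
    intro c hc
    rw [mem_leadingExponents, ← Nat.mul_right_inj hq.ne', sum_mod_add_sum_div (p ^ k) α]
    have := (mem_carryExponents.1 hc).2.1
    have e : r * p ^ (k + 1) = p ^ k * (r * p) := by ring
    rw [e]
    simp only [mul_add] at this ⊢
    omega
  rw [mem_indecomposableExponents hp]
  constructor
  · rintro ⟨h1, h2⟩
    obtain ⟨c, hc⟩ := exists_carry hp hr (s := r * p) hk (by rw [h1]; ring) h2
    exact ⟨c, hc, (key c hc).2 h1⟩
  · rintro ⟨c, hc, hγ⟩
    exact ⟨(key c hc).1 hγ, forall_of_mem_carryExponents hp hc⟩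

/-- Cut at `p ^ k`: the next digits, of sum `s`, satisfy `r + (c + 1) + s = p (r + d)`, which is the
degree defining an entry of `U`. -/
theorem card_carryExponents_succ (hp : 0 < p) (hr : r < m) {k : ℕ} (hk : 1 ≤ k) (d : ℕ) :
    (carryExponents p r m (k + 1) d).card = ∑ c : Fin (m - r - 1),
      (carryExponents p r m k (c + 1)).card *
        (boundedExponents p m ((r : ℤ) * ((p : ℤ) - 1) + (d : ℤ) * (p : ℤ)
          - ((c : ℕ) + 1 : ℤ))).card := by
  have hq : 0 < p ^ k := pow_pos hp k
  refine Finset.card_eq_sum_mod_div hq (fun c β hβ => (mem_carryExponents.1 hβ).1)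
    (carryExponents_disjoint hp) fun α => ?_
  have key : ∀ c : Fin (m - r - 1), (fun j => α j % p ^ k) ∈ carryExponents p r m k (c + 1) →
      ((fun j => α j / p ^ k) ∈ boundedExponents p m ((r : ℤ) * ((p : ℤ) - 1) + (d : ℤ) * (p : ℤ)
          - ((c : ℕ) + 1 : ℤ)) ↔
        (∀ j, α j < p ^ (k + 1)) ∧ ∑ j, α j + r = p ^ (k + 1) * (r + d)) := by
    intro c hc
    rw [mem_boundedExponents]
    refine and_congr (forall_congr' fun j => ?_) ?_
    · rw [Nat.div_lt_iff_lt_mul hq, pow_succ']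
    · rw [sum_mod_add_sum_div (p ^ k) α]
      have h1 := (mem_carryExponents.1 hc).2.1
      have e : p ^ (k + 1) * (r + d) = p ^ k * (p * (r + d)) := by ring
      have e' : ∑ j, α j % p ^ k + p ^ k * ∑ j, α j / p ^ k + r
          = p ^ k * (r + (c + 1) + ∑ j, α j / p ^ k) := by
        rw [mul_add, ← h1]
        ring
      rw [e, e', Nat.mul_right_inj hq.ne']
      zify
      constructor <;> intro h <;> linarith
  rw [mem_carryExponents]
  constructor
  · rintro ⟨h0, h1, h2⟩
    obtain ⟨c, hc⟩ := exists_carry hp hr (s := p * (r + d)) hk (by rw [h1]; ring) h2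
    exact ⟨c, hc, (key c hc).2 ⟨h0, h1⟩⟩
  · rintro ⟨c, hc, hγ⟩
    exact ⟨((key c hc).1 hγ).1, ((key c hc).1 hγ).2, forall_of_mem_carryExponents hp hc⟩

/-- Makes the initial vector nonzero. The degree `r(p-1) + p` fits since `p ≤ 2(p-1)` and `r + 2 ≤
m`. -/
theorem carryExponents_one_nonempty (hp : 2 ≤ p) (hm : r + 1 < m) :
    (carryExponents p r m 1 1).Nonempty := by
  obtain ⟨β, hβ⟩ := boundedExponents_nonempty (q := p) (m := m)
    (k := (r : ℤ) * ((p : ℤ) - 1) + p) (by omega)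
    (add_nonneg (mul_nonneg (by omega) (by omega)) (by omega))
    (by
      have : ((r : ℤ) + 2) * (p - 1) ≤ m * (p - 1) :=
        mul_le_mul_of_nonneg_right (by omega) (by omega)
      linarith [(by exact_mod_cast hp : (2 : ℤ) ≤ p)])
  rw [mem_boundedExponents] at hβ
  refine ⟨β, mem_carryExponents.2 ⟨by simpa using hβ.1, ?_, fun i _ _ => by omega⟩⟩
  zify
  have := hβ.2
  push_cast at this
  rw [this]
  ring

theorem leadingExponents_one_nonempty (hp : 2 ≤ p) (hr : 1 ≤ r) (hm : 0 < m) :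
    (leadingExponents p r m 1).Nonempty := by
  refine ⟨Pi.single ⟨0, hm⟩ (r * p - r - 1), mem_leadingExponents.2 ?_⟩
  rw [Finset.sum_pi_single']
  have : r * 2 ≤ r * p := Nat.mul_le_mul_left r hp
  simp only [Finset.mem_univ, if_true]
  omega

variable (R : Type*) [CommRing R] [Nontrivial R]

theorem carryExponents_eq_pow_mulVec (hp : 0 < p) (hr : r < m) (k : ℕ) :
    (fun c : Fin (m - r - 1) => ((carryExponents p r m (k + 1) (c + 1)).card : ℝ)) =
      Matrix.mulVec (matrixU p r m R ^ k) fun c => ((carryExponents p r m 1 (c + 1)).card : ℝ) := by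
  induction k with
  | zero => simp
  | succ k ih =>
    rw [pow_succ', ← Matrix.mulVec_mulVec, ← ih]
    funext c
    rw [card_carryExponents_succ hp hr (Nat.le_add_left 1 k)]
    simp only [Matrix.mulVec, dotProduct, matrixU_apply]
    push_cast
    exact Finset.sum_congr rfl fun d _ => mul_comm _ _

open Filter Asymptotics in
theorem card_indecomposableExponents_isTheta (hp : 2 ≤ p) (hr : 1 ≤ r) (hm : r + 1 < m) {l : ℝ}
    (hl : 0 < l) {x : Fin (m - r - 1) → ℝ} (hx : ∀ i, 0 < x i)
    (h : Matrix.mulVec (matrixU p r m R) x = l • x) :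
    (fun e => ((indecomposableExponents p r m e).card : ℝ)) =Θ[atTop] fun e : ℕ => l ^ e := by
  have hp0 : 0 < p := by omega
  have hrm : r < m := by omega
  have : Nonempty (Fin (m - r - 1)) := ⟨⟨0, by omega⟩⟩
  have hth := (matrixU_isPrimitive p r m R hp hm).isTheta_dotProduct_pow_mulVec hl hx h
    (v := fun c => ((carryExponents p r m 1 (c + 1)).card : ℝ))
    (w := fun c => ((leadingExponents p r m (c + 1)).card : ℝ))
    (fun _ => Nat.cast_nonneg _)
    ⟨⟨0, by omega⟩, Nat.cast_ne_zero.2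
      (Finset.card_pos.2 (carryExponents_one_nonempty hp hm)).ne'⟩
    (fun _ => Nat.cast_nonneg _)
    ⟨⟨0, by omega⟩, Nat.cast_ne_zero.2
      (Finset.card_pos.2 (leadingExponents_one_nonempty hp hr (by omega))).ne'⟩
  -- Degree `e` uses `U ^ (e - 2)`: the lowest digits form the initial vector and the leading part
  -- is weighted separately.
  have hth' := And.intro (hth.1.comp_tendsto (tendsto_sub_atTop_nat 2))
    (hth.2.comp_tendsto (tendsto_sub_atTop_nat 2))
  have heq : (fun e => ((indecomposableExponents p r m e).card : ℝ)) =ᶠ[atTop]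
      (fun k : ℕ => dotProduct (fun c : Fin (m - r - 1) =>
        ((leadingExponents p r m (c + 1)).card : ℝ)) (Matrix.mulVec (matrixU p r m R ^ k)
          fun c => ((carryExponents p r m 1 (c + 1)).card : ℝ))) ∘ fun e => e - 2 := by
    filter_upwards [eventually_ge_atTop 2] with e he
    obtain ⟨k, rfl⟩ := Nat.exists_eq_add_of_le' he
    rw [Function.comp_apply, Nat.add_sub_cancel, ← carryExponents_eq_pow_mulVec R hp0 hrm,
      card_indecomposableExponents_succ hp0 hrm (Nat.le_add_left 1 k)]
    simp only [dotProduct]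
    push_cast
    exact Finset.sum_congr rfl fun d _ => mul_comm _ _
  have heq' : ((fun k : ℕ => l ^ k) ∘ fun e => e - 2) =ᶠ[atTop] fun e : ℕ => (l ^ 2)⁻¹ * l ^ e := by
    filter_upwards [eventually_ge_atTop 2] with e he
    rw [Function.comp_apply, pow_sub₀ _ hl.ne' he, mul_comm]
  refine (heq.trans_isTheta (IsTheta.trans_eventuallyEq hth' heq')).trans ?_
  exact (isTheta_refl _ _).const_mul_left (inv_ne_zero (pow_ne_zero 2 hl.ne'))

end Counting

/-! ### Generators of a free quotient. -/

section IndecomposableQuotient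

open DirectSum

variable {A : ℕ → Type*} [∀ i, AddCommGroup (A i)] [GRing A] {e : ℕ} {ι : Type*} [Fintype ι]

/-- An additive map compatible with the graded multiplication by `A 0` is linear. -/
def linearMapOfGradeZero (f : A e →+ (ι → A 0)) (hf : ∀ (c : A 0) (a : A e) (i : ι),
    f ((GradedMonoid.GradeZero.smul A e).smul c a) i
      = (GradedMonoid.GradeZero.smul A 0).smul c (f a i)) : A e →ₗ[A 0] (ι → A 0) where
  __ := f
  map_smul' c a := funext fun i => hf c a i

theorem finite_quotient_decomposablePart
    (f : A e →ₗ[A 0] (ι → A 0)) (hker : LinearMap.ker f = decomposablePart A e)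
    (hf : Function.Surjective f) :
    Module.Finite (A 0) (A e ⧸ decomposablePart A e) := by
  rw [← hker]
  exact Module.Finite.equiv (f.quotKerEquivOfSurjective hf).symm

/-- The quotient is isomorphic to a free module, whose minimal number of generators is its rank. -/
theorem complexitySeq_eq_card [StrongRankCondition (A 0)]
    (f : A e →ₗ[A 0] (ι → A 0)) (hker : LinearMap.ker f = decomposablePart A e)
    (hf : Function.Surjective f) :
    complexitySeq A e = Fintype.card ι := by
  have := Module.Free.of_equiv (f.quotKerEquivOfSurjective hf).symm
  rw [complexitySeq, ← hker, ← Module.finrank_eq_spanFinrank_of_free,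
    (f.quotKerEquivOfSurjective hf).finrank_eq, Module.finrank_fintype_fun_eq_card]

end IndecomposableQuotient

/-! ### Decomposable elements of `T(V_r(R[x_1, …, x_m]))`. -/

section Decomposable

open DirectSum

variable {p r m : ℕ} {R : Type*} [CommRing R]

/-- The exponent vector of a monomial as a finitely supported function. -/
noncomputable abbrev exponent (α : Fin m → ℕ) : Fin m →₀ ℕ := Finsupp.equivFunOnFinite.symm α

theorem degree_exponent (α : Fin m → ℕ) : (exponent α).degree = ∑ j, α j := by
  rw [Finsupp.degree_eq_sum]
  rfl

namespace TwistedVeronese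

/-- An element of a graded piece, as a polynomial. -/
noncomputable def valHom (e : ℕ) : TwistedVeronese p r m R e →+ MvPolynomial (Fin m) R where
  toFun a := a.val
  map_zero' := rfl
  map_add' _ _ := rfl

/-- A homogeneous polynomial of the right degree, as an element of a graded piece. -/
def mk {e : ℕ} (f : MvPolynomial (Fin m) R) (hf : f.IsHomogeneous (r * (p ^ e - 1))) :
    TwistedVeronese p r m R e := ⟨f, hf⟩

theorem isHomogeneous_val {e : ℕ} (a : TwistedVeronese p r m R e) :
    a.val.IsHomogeneous (r * (p ^ e - 1)) := a.2

theorem val_injective {e : ℕ} :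
    Function.Injective (TwistedPiece.val : TwistedVeronese p r m R e → MvPolynomial (Fin m) R) :=
  Subtype.val_injective

theorem val_eq_C (c : TwistedVeronese p r m R 0) :
    c.val = MvPolynomial.C (MvPolynomial.coeff 0 c.val) := by
  have h := isHomogeneous_val c
  rw [pow_zero, Nat.sub_self, mul_zero] at h
  exact MvPolynomial.totalDegree_eq_zero_iff_eq_C.1 (Nat.le_zero.1 h.totalDegree_le)

variable [Fact p.Prime]

theorem val_gMul {i j : ℕ} (a : TwistedVeronese p r m R i) (b : TwistedVeronese p r m R j) :
    (GradedMonoid.GMul.mul a b : TwistedVeronese p r m R (i + j)).val = a.val * b.val ^ p ^ i := rfl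

theorem val_smul {e : ℕ} (c : TwistedVeronese p r m R 0) (a : TwistedVeronese p r m R e) :
    (c • a).val = c.val * a.val := by
  have h := congrArg (fun x : GradedMonoid (TwistedVeronese p r m R) => x.2.val)
    (GradedMonoid.mk_zero_smul c a)
  exact h.trans ((val_gMul c a).trans (by rw [pow_zero, pow_one]))

variable [CharP R p]

theorem of_mul_of_eq {i j e : ℕ} (h : i + j = e) (a : TwistedVeronese p r m R i)
    (b : TwistedVeronese p r m R j) (c : TwistedVeronese p r m R e)
    (hc : c.val = a.val * b.val ^ p ^ i) :
    of (TwistedVeronese p r m R) i a * of (TwistedVeronese p r m R) j b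
      = of (TwistedVeronese p r m R) e c := by
  rw [of_mul_of]
  exact of_eq_of_gradedMonoid_eq (TwistedPiece.mk_eq _ _ h hc.symm)

/-- By Frobenius, the exponents of `g ^ p ^ i` are multiples of `p ^ i`. The factor `f` would have
to supply an exponent dominating `α mod p^i`, whose degree exceeds that of `f`. -/
theorem coeff_mul_pow_eq_zero {e i : ℕ} {α : Fin m → ℕ}
    (hα : α ∈ indecomposableExponents p r m e) (h₁ : 1 ≤ i) (h₂ : i < e)
    {f g : MvPolynomial (Fin m) R} (hf : f.IsHomogeneous (r * (p ^ i - 1))) :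
    MvPolynomial.coeff (exponent α) (f * g ^ p ^ i) = 0 := by
  have hp : 0 < p := (Fact.out : p.Prime).pos
  rw [g.as_sum, sum_pow_char_pow, Finset.mul_sum, MvPolynomial.coeff_sum]
  refine Finset.sum_eq_zero fun γ _ => ?_
  rw [MvPolynomial.monomial_pow, MvPolynomial.coeff_mul_monomial']
  split_ifs with hle
  · by_contra hne
    have hdeg := hf.sum_exponents_eq (left_ne_zero_of_mul hne)
    have hlt := ((mem_indecomposableExponents hp).1 hα).2 i h₁ h₂
    have hmod : ∑ j, α j % p ^ i ≤ ∑ j, (exponent α - p ^ i • γ) j := by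
      refine Finset.sum_le_sum fun j _ => ?_
      have hj : p ^ i * γ j ≤ α j := hle j
      change α j % p ^ i ≤ α j - p ^ i * γ j
      obtain ⟨d, hd⟩ := Nat.exists_eq_add_of_le hj
      rw [hd, Nat.mul_add_mod, Nat.add_sub_cancel_left]
      exact Nat.mod_le _ _
    rw [hdeg, Nat.mul_sub, mul_one] at hmod
    have : r ≤ r * p ^ i := Nat.le_mul_of_pos_right r (pow_pos hp i)
    omega
  · rfl

/-- The coefficients at indecomposable exponents vanish on decomposable elements. -/
theorem coeff_eq_zero_of_mem_gradedGen {e : ℕ} (he : 0 < e) {α : Fin m → ℕ}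
    (hα : α ∈ indecomposableExponents p r m e) {x : ⨁ i, TwistedVeronese p r m R i}
    (hx : x ∈ gradedGen (TwistedVeronese p r m R) (e - 1)) :
    MvPolynomial.coeff (exponent α) (x e).val = 0 := by
  classical
  set φ : (⨁ i, TwistedVeronese p r m R i) →+ R :=
    (MvPolynomial.coeffAddMonoidHom (exponent α)).comp
      ((valHom e).comp (DFinsupp.evalAddMonoidHom e)) with hφ
  have hφ' : ∀ x, φ x = MvPolynomial.coeff (exponent α) (x e).val := fun x => rfl
  have hne : ∀ i (a : TwistedVeronese p r m R i), i ≠ e → φ (of _ i a) = 0 := by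
    intro i a hi
    rw [hφ', of_eq_of_ne _ _ _ hi.symm]
    rfl
  have hself : ∀ a : TwistedVeronese p r m R e,
      φ (of _ e a) = MvPolynomial.coeff (exponent α) a.val := by
    intro a
    rw [hφ', of_eq_same]
  change φ x = 0
  induction hx using Subring.closure_induction with
  | mem x hx =>
    obtain ⟨i, hi, a, rfl⟩ := hx
    exact hne i a (by omega)
  | zero => exact map_zero φ
  | one => exact hne 0 _ he.ne
  | add x y _ _ hx hy => rw [map_add, hx, hy, add_zero]
  | neg x _ hx => rw [map_neg, hx, neg_zero]
  | mul x y _ _ hx hy =>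
    rw [mul_eq_sum_support_ghas_mul, map_sum]
    refine Finset.sum_eq_zero ?_
    rintro ⟨i, j⟩ _
    simp only
    -- A factor of degree `0` is a constant, so the coefficient is a multiple of one that vanishes
    -- by induction; if both degrees are positive, `coeff_mul_pow_eq_zero` applies.
    by_cases hij : i + j = e
    · rcases Nat.eq_zero_or_pos i with rfl | hi
      · obtain rfl : j = e := by omega
        have h : of (TwistedVeronese p r m R) _ (GradedMonoid.GMul.mul (x 0) (y j))
            = of _ j (x 0 • y j) :=
          of_eq_of_gradedMonoid_eq (GradedMonoid.mk_zero_smul _ _).symm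
        rw [h, hself, val_smul, val_eq_C, MvPolynomial.coeff_C_mul, ← hφ' y, hy, mul_zero]
      · rcases Nat.eq_zero_or_pos j with rfl | hj
        · obtain rfl : i = e := by omega
          have h := hself (GradedMonoid.GMul.mul (x i) (y 0) : TwistedVeronese p r m R (i + 0))
          refine h.trans ?_
          rw [val_gMul, val_eq_C (y 0), ← map_pow, mul_comm, MvPolynomial.coeff_C_mul, ← hφ' x,
            hx, mul_zero]
        · subst hij
          rw [hself, val_gMul]
          exact coeff_mul_pow_eq_zero hα hi (by omega) (isHomogeneous_val _)
    · exact hne _ _ hij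

/-- A monomial whose exponent is not indecomposable is a product of elements of smaller degree. -/
theorem of_monomial_mem_gradedGen {e : ℕ} {α : Fin m → ℕ} (hα : ∑ j, α j + r = r * p ^ e)
    (hα' : α ∉ indecomposableExponents p r m e) (c : R) (a : TwistedVeronese p r m R e)
    (ha : a.val = MvPolynomial.monomial (exponent α) c) :
    of (TwistedVeronese p r m R) e a ∈ gradedGen (TwistedVeronese p r m R) (e - 1) := by
  have hp : 0 < p := (Fact.out : p.Prime).pos
  rw [mem_indecomposableExponents hp, not_and] at hα'
  have h := hα' hα
  push Not at h
  obtain ⟨i, h₁, h₂, hi⟩ := h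
  obtain ⟨j, rfl⟩ := Nat.exists_eq_add_of_lt h₂
  rw [add_assoc] at hα
  have hq : 0 < p ^ i := pow_pos hp i
  have hsum := sum_mod_add_sum_div (p ^ i) α
  obtain ⟨s, hs⟩ : p ^ i ∣ r * p ^ i - (∑ j, α j % p ^ i + r) := by
    refine Nat.dvd_sub (dvd_mul_left _ _) ?_
    have h1 : p ^ i ∣ (∑ j, α j % p ^ i + r) + p ^ i * ∑ j, α j / p ^ i :=
      ⟨r * p ^ (j + 1), by rw [add_right_comm, ← hsum, hα]; ring⟩
    exact (Nat.dvd_add_left (dvd_mul_right _ _)).1 h1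
  have hs' : ∑ j, α j % p ^ i + p ^ i * s + r = r * p ^ i := by omega
  have hpow : r * p ^ i ≤ r * p ^ (i + (j + 1)) :=
    Nat.mul_le_mul_left r (Nat.pow_le_pow_right hp (by omega))
  have hsle : s ≤ (exponent fun j => α j / p ^ i).degree := by
    rw [degree_exponent]
    refine le_of_mul_le_mul_left ?_ hq
    omega
  -- `α mod p^i` falls short of degree `r(p^i - 1)` by `p^i s`. Moving a part `δ` of size `s` from
  -- the high digits to the left factor makes up for it.
  obtain ⟨δ, hδ, hδs⟩ := Finsupp.exists_le_degree_eq _ s hsle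
  have hδ' : ∀ j, δ j ≤ α j / p ^ i := fun j => hδ j
  rw [Finsupp.degree_eq_sum] at hδs
  set β : Fin m → ℕ := fun j => α j % p ^ i + p ^ i * δ j with hβ
  set γ : Fin m → ℕ := fun j => α j / p ^ i - δ j with hγ
  have hβγ : exponent α = exponent β + p ^ i • exponent γ := by
    ext j
    change α j = (α j % p ^ i + p ^ i * δ j) + p ^ i * (α j / p ^ i - δ j)
    rw [add_assoc, ← mul_add, Nat.add_sub_of_le (hδ' j), Nat.mod_add_div]
  have hβs : ∑ j, β j + r = r * p ^ i := by
    rw [← hs', hβ, Finset.sum_add_distrib, ← Finset.mul_sum, hδs]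
  have hγs : ∑ j, γ j + r = r * p ^ (j + 1) := by
    have h1 := congrArg Finsupp.degree hβγ
    rw [map_add, map_nsmul, degree_exponent, degree_exponent, degree_exponent, smul_eq_mul] at h1
    have h2 : p ^ i * (∑ j, γ j + r) = p ^ i * (r * p ^ (j + 1)) := by
      have e1 : p ^ i * (r * p ^ (j + 1)) = r * p ^ (i + (j + 1)) := by ring
      rw [e1, mul_add, mul_comm (p ^ i) r]
      omega
    exact Nat.eq_of_mul_eq_mul_left hq h2
  have hdeg : ∀ {k : ℕ} {β : Fin m → ℕ}, ∑ j, β j + r = r * p ^ k → ∀ c : R,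
      (MvPolynomial.monomial (exponent β) c).IsHomogeneous (r * (p ^ k - 1)) := by
    intro k β h c
    refine MvPolynomial.isHomogeneous_monomial _ ?_
    rw [degree_exponent, Nat.mul_sub, mul_one, ← h, Nat.add_sub_cancel]
  rw [← of_mul_of_eq (add_assoc i j 1).symm (mk (MvPolynomial.monomial (exponent β) c) (hdeg hβs c))
    (mk (MvPolynomial.monomial (exponent γ) 1) (hdeg hγs 1)) a]
  · exact mul_mem (Subring.subset_closure ⟨i, by omega, _, rfl⟩)
      (Subring.subset_closure ⟨j + 1, by omega, _, rfl⟩)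
  · rw [ha]
    change _ = MvPolynomial.monomial (exponent β) c * MvPolynomial.monomial (exponent γ) 1 ^ p ^ i
    rw [MvPolynomial.monomial_pow, one_pow, MvPolynomial.monomial_mul, mul_one, ← hβγ]

theorem mem_decomposablePart_iff {e : ℕ} (he : 0 < e) {a : TwistedVeronese p r m R e} :
    a ∈ decomposablePart (TwistedVeronese p r m R) e ↔
      ∀ α ∈ indecomposableExponents p r m e, MvPolynomial.coeff (exponent α) a.val = 0 := by
  have hp : 0 < p := (Fact.out : p.Prime).pos
  constructor
  · intro h α hα
    have := coeff_eq_zero_of_mem_gradedGen he hα (x := of _ e a) h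
    rwa [of_eq_same] at this
  · intro h
    have hdeg : ∀ v ∈ a.val.support, ∑ j, v j + r = r * p ^ e := by
      intro v hv
      rw [(isHomogeneous_val a).sum_exponents_eq (MvPolynomial.mem_support_iff.1 hv), Nat.mul_sub,
        mul_one, Nat.sub_add_cancel (Nat.le_mul_of_pos_right r (pow_pos hp e))]
    have hhom : ∀ v ∈ a.val.support,
        (MvPolynomial.monomial v (a.val.coeff v)).IsHomogeneous (r * (p ^ e - 1)) := by
      intro v hv
      refine MvPolynomial.isHomogeneous_monomial _ ?_
      rw [Finsupp.degree_eq_sum, Nat.mul_sub, mul_one, ← hdeg v hv, Nat.add_sub_cancel]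
    have hsum : a = ∑ v ∈ a.val.support.attach,
        mk (MvPolynomial.monomial v.1 (a.val.coeff v.1)) (hhom v.1 v.2) := by
      refine val_injective ?_
      change _ = valHom e _
      rw [map_sum]
      change _ = ∑ v ∈ a.val.support.attach, MvPolynomial.monomial v.1 (a.val.coeff v.1)
      rw [Finset.sum_attach a.val.support fun v => MvPolynomial.monomial v (a.val.coeff v)]
      exact a.val.as_sum
    rw [hsum]
    refine Submodule.sum_mem _ fun v _ => ?_
    have hv : exponent (v.1 : Fin m → ℕ) = v.1 := Finsupp.equivFunOnFinite.symm_apply_apply v.1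
    refine of_monomial_mem_gradedGen (hdeg v.1 v.2) (fun hv' => ?_) (a.val.coeff v.1) _ ?_
    · have := h _ hv'
      rw [hv] at this
      exact MvPolynomial.mem_support_iff.1 v.2 this
    · rw [hv]
      rfl

/-- The coefficients at indecomposable exponents, as an additive map. -/
noncomputable def indecomposableCoeffHom (e : ℕ) : TwistedVeronese p r m R e →+
    (indecomposableExponents p r m e → TwistedVeronese p r m R 0) where
  toFun a α := mk (MvPolynomial.C (MvPolynomial.coeff (exponent α.1) a.val))
    (by simpa using MvPolynomial.isHomogeneous_C (Fin m) _)
  map_zero' := funext fun α => val_injective (MvPolynomial.C_0 (R := R))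
  map_add' a b := funext fun α => val_injective (by
    change MvPolynomial.C (MvPolynomial.coeff _ (a.val + b.val)) =
      MvPolynomial.C (MvPolynomial.coeff _ a.val) + MvPolynomial.C (MvPolynomial.coeff _ b.val)
    rw [MvPolynomial.coeff_add, map_add])

theorem val_indecomposableCoeffHom {e : ℕ} (a : TwistedVeronese p r m R e)
    (α : indecomposableExponents p r m e) : (indecomposableCoeffHom e a α).val =
      MvPolynomial.C (MvPolynomial.coeff (exponent α.1) a.val) := rfl

/-- The coefficients at indecomposable exponents, as a linear map. -/
noncomputable def indecomposableCoeff (e : ℕ) :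
    TwistedVeronese p r m R e →ₗ[TwistedVeronese p r m R 0]
      (indecomposableExponents p r m e → TwistedVeronese p r m R 0) :=
  linearMapOfGradeZero (indecomposableCoeffHom e) fun c a α => val_injective (by
    refine (val_indecomposableCoeffHom _ α).trans (Eq.trans ?_ (val_smul c _).symm)
    refine (congrArg (fun f => MvPolynomial.C (MvPolynomial.coeff (exponent α.1) f))
      (val_smul c a)).trans ?_
    rw [val_eq_C c, MvPolynomial.coeff_C_mul, map_mul, val_indecomposableCoeffHom])

theorem val_indecomposableCoeff {e : ℕ} (a : TwistedVeronese p r m R e)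
    (α : indecomposableExponents p r m e) : (indecomposableCoeff e a α).val =
      MvPolynomial.C (MvPolynomial.coeff (exponent α.1) a.val) := rfl

theorem ker_indecomposableCoeff {e : ℕ} (he : 0 < e) :
    LinearMap.ker (indecomposableCoeff (p := p) (r := r) (m := m) (R := R) e)
      = decomposablePart (TwistedVeronese p r m R) e := by
  ext a
  rw [mem_decomposablePart_iff he, LinearMap.mem_ker]
  constructor
  · intro h α hα
    have := congrArg TwistedPiece.val (congrFun h ⟨α, hα⟩)
    rw [val_indecomposableCoeff] at this
    exact MvPolynomial.C_eq_zero.1 this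
  · intro h
    funext α
    refine val_injective ?_
    rw [val_indecomposableCoeff, h α.1 α.2, map_zero]
    rfl

theorem indecomposableCoeff_surjective (e : ℕ) :
    Function.Surjective (indecomposableCoeff (p := p) (r := r) (m := m) (R := R) e) := by
  classical
  have hp : 0 < p := (Fact.out : p.Prime).pos
  intro g
  have hhom : (∑ α : indecomposableExponents p r m e,
      MvPolynomial.monomial (exponent α.1) (MvPolynomial.coeff 0 (g α).val)).IsHomogeneous
        (r * (p ^ e - 1)) := by
    refine MvPolynomial.IsHomogeneous.sum _ _ _ fun α _ => MvPolynomial.isHomogeneous_monomial _ ?_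
    rw [degree_exponent, Nat.mul_sub, mul_one, ← ((mem_indecomposableExponents hp).1 α.2).1,
      Nat.add_sub_cancel]
  refine ⟨mk _ hhom, funext fun α => val_injective ?_⟩
  rw [val_indecomposableCoeff, val_eq_C (g α)]
  change MvPolynomial.C (MvPolynomial.coeff _ (∑ α : indecomposableExponents p r m e, _)) = _
  rw [MvPolynomial.coeff_sum]
  simp only [MvPolynomial.coeff_monomial, Finsupp.equivFunOnFinite.symm.injective.eq_iff,
    Subtype.coe_inj, Finset.sum_ite_eq', Finset.mem_univ, if_true]

theorem degreewiseFG : DegreewiseFG (TwistedVeronese p r m R) := by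
  intro e
  rcases Nat.eq_zero_or_pos e with rfl | he
  · exact Module.Finite.quotient (TwistedVeronese p r m R 0) _
  · exact finite_quotient_decomposablePart _ (ker_indecomposableCoeff he)
      (indecomposableCoeff_surjective e)

/-- In degree `0` the twist is by `p ^ 0 = 1`, so `A_0` is a nontrivial commutative ring. -/
theorem strongRankCondition : StrongRankCondition (TwistedVeronese p r m R 0) := by
  have : Nontrivial R := CharP.nontrivial_of_char_ne_one (Fact.out : p.Prime).ne_one
  let _ : CommRing (TwistedVeronese p r m R 0) :=
    { (inferInstance : Ring (TwistedVeronese p r m R 0)) with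
      mul_comm := fun a b => val_injective (by
        change (a • b).val = (b • a).val
        rw [val_smul, val_smul, mul_comm]) }
  have : Nontrivial (TwistedVeronese p r m R 0) :=
    ⟨⟨1, 0, fun h => one_ne_zero (α := MvPolynomial (Fin m) R) (congrArg TwistedPiece.val h)⟩⟩
  exact commRing_strongRankCondition (TwistedVeronese p r m R 0)

theorem complexitySeq_eq {e : ℕ} (he : 0 < e) :
    complexitySeq (TwistedVeronese p r m R) e = (indecomposableExponents p r m e).card := by
  have := strongRankCondition (p := p) (r := r) (m := m) (R := R)
  rw [complexitySeq_eq_card _ (ker_indecomposableCoeff he) (indecomposableCoeff_surjective e),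
    Fintype.card_coe]

end TwistedVeronese

end Decomposable

/-! ### From growth to complexity. -/

section ComplexityOfGrowth

open Filter Asymptotics

theorem complexity_eq_of_isTheta (A : ℕ → Type*) [∀ i, AddCommGroup (A i)] [DirectSum.GRing A]
    {l : ℝ} (hl : 0 < l)
    (h : (fun e : ℕ => (complexitySeq A e : ℝ)) =Θ[atTop] fun e : ℕ => l ^ e) :
    complexity A = ENNReal.ofReal l := by
  refine le_antisymm (sInf_le ⟨l.toNNReal, rfl, ?_⟩) (le_sInf ?_)
  · rw [Real.coe_toNNReal l hl.le]
    exact h.1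
  · rintro _ ⟨n, rfl, hn⟩
    rw [ENNReal.ofReal, ENNReal.coe_le_coe, Real.toNNReal_le_iff_le_coe]
    by_contra! hlt
    -- An admissible `n < l` would give `l ^ e = O(n ^ e) = o(l ^ e)`.
    have h1 := (h.2.trans hn).trans_isLittleO (isLittleO_pow_pow_of_lt_left n.2 hlt)
    exact isLittleO_irrefl (Frequently.of_forall fun e => (pow_pos hl e).ne') h1

end ComplexityOfGrowth

theorem mainTheorem3 (p : ℕ) [Fact p.Prime] (R : Type*) [CommRing R] [CharP R p]
    (r m : ℕ) (hr : 1 ≤ r) (hm : r + 1 < m) :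
    (matrixU p r m R).IsPrimitive ∧
    DegreewiseFG (TwistedVeronese p r m R) ∧
    ∃ l : ℝ, 0 < l ∧ IsPerronFrobeniusEigenvalue (matrixU p r m R) (l : ℂ) ∧
      complexity (TwistedVeronese p r m R) = ENNReal.ofReal l := by
  have hp : 2 ≤ p := (Fact.out : p.Prime).two_le
  have : Nontrivial R := CharP.nontrivial_of_char_ne_one (Fact.out : p.Prime).ne_one
  have : Nonempty (Fin (m - r - 1)) := ⟨⟨0, by omega⟩⟩
  have hU := matrixU_isPrimitive p r m R hp hm
  obtain ⟨l, hl, x, hx, h⟩ := hU.exists_pos_eigenvector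
  refine ⟨hU, TwistedVeronese.degreewiseFG, l, hl, hU.isPerronFrobeniusEigenvalue hl hx h,
    complexity_eq_of_isTheta _ hl ?_⟩
  refine Filter.EventuallyEq.trans_isTheta ?_
    (card_indecomposableExponents_isTheta R hp hr hm hl hx h)
  filter_upwards [Filter.eventually_gt_atTop 0] with e he
  rw [TwistedVeronese.complexitySeq_eq he]
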